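/- Let $k$ be an algebraically closed field of characteristic $0$ and let $N\ge 2$ and $n\ge 1$ be integers. For a set $X$ of $n$ distinct points of $\mathbb{P}^N_k$, let $\alpha(X)$ be the least degree of a nonzero form in $k[x_0,\dots,x_N]$ vanishing at every point of $X$, and let $$\epsilon(N,X)=\sqrt[N-1]{\inf_F\ \frac{\deg F}{\sum_{p\in X}\operatorname{mult}_p(F)}}$$ be the multipoint Seshadri constant, where the infimum is taken over all hypersurfaces $F\subset\mathbb{P}^N_k$ passing through at least one point of $X$. Let $\operatorname{Sym}^n(\mathbb{P}^N_k)$ be the Chow variety of effective $0$-cycles of degree $n$. Then for very general $X$ one has $$\epsilon(N,X)\ \ge\ \sqrt[N-1]{\frac{\alpha(X)+N-1}{nN}}.$$ That is, there are dense Zariski-open subsets $U_1,U_2,\dots$ of $\operatorname{Sym}^n(\mathbb{P}^N_k)$ such that $W=\bigcap_{i\ge 1}U_i$ contains the cycle of some set of $n$ distinct points, and the inequality holds for every set $X=\{p_1,\dots,p_n\}$ of $n$ distinct points with $p_1+\dots+p_n\in W$. -/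

import Mathlib

namespace SeshadriPoints

/-- The set of closed points of projective `N`-space over `k`. -/
abbrev ProjSpace (k : Type*) [Field k] (N : ℕ) : Type _ :=
  Projectivization k (Fin (N + 1) → k)

section Zariski

variable (k : Type*) [Field k] (N n : ℕ)

/-- `f` is multihomogeneous, of multidegree `d`, in the `n` groups of variables
`x_{i0}, …, x_{iN}`. -/
def IsMultihomogeneous (f : MvPolynomial (Fin n × Fin (N + 1)) k) (d : Fin n → ℕ) : Prop :=
  MvPolynomial.IsWeightedHomogeneous (fun ij => (Pi.single ij.1 1 : Fin n → ℕ)) f d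

/-- The set of points of `(ℙ^N)^n` at which `f` does not vanish. For multihomogeneous `f` it does
not depend on the chosen homogeneous coordinates. -/
def nonvanishingLocus (f : MvPolynomial (Fin n × Fin (N + 1)) k) :
    Set (Fin n → ProjSpace k N) :=
  {p | MvPolynomial.eval (fun ij => (p ij.1).rep ij.2) f ≠ 0}

/-- The Zariski topology on the product variety `(ℙ^N)^n`: it is generated by the nonvanishing
loci of the multihomogeneous polynomials. (This is not the product topology.) -/
@[reducible] def zariskiTopology : TopologicalSpace (Fin n → ProjSpace k N) :=
  TopologicalSpace.generateFrom
    {D | ∃ (f : MvPolynomial (Fin n × Fin (N + 1)) k) (d : Fin n → ℕ),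
      IsMultihomogeneous k N n f d ∧ D = nonvanishingLocus k N n f}

/-- The Chow variety of effective `0`-cycles of degree `n` in `ℙ^N`, that is, the symmetric product
`Sym^n(ℙ^N)`: its points are the multisets of `n` points of `ℙ^N`. -/
def ZeroCycle : Type _ := Sym (ProjSpace k N) n

variable {k N n}

/-- The quotient map `(ℙ^N)^n → Sym^n(ℙ^N)`, `(p_1, …, p_n) ↦ p_1 + ⋯ + p_n`. -/
def ZeroCycle.ofTuple (p : Fin n → ProjSpace k N) : ZeroCycle k N n :=
  (⟨Finset.univ.val.map p, by simp⟩ : Sym (ProjSpace k N) n)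

/-- The reduced `0`-cycle of a set of `n` distinct points. -/
def ZeroCycle.ofFinset (X : Finset (ProjSpace k N)) (hX : X.card = n) : ZeroCycle k N n :=
  (⟨X.val, hX⟩ : Sym (ProjSpace k N) n)

/-- The Zariski topology of `Sym^n(ℙ^N) = (ℙ^N)^n / S_n`, which is the quotient topology. -/
instance : TopologicalSpace (ZeroCycle k N n) :=
  TopologicalSpace.coinduced ZeroCycle.ofTuple (zariskiTopology k N n)

variable (k N n)

/-- The property `P` of finite sets of points holds for (every set of) `n` very general points of
`ℙ^N`: there is a countable intersection `W` of dense Zariski-open subsets of the Chow variety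
which contains the cycle of some set of `n` distinct points, such that `P X` for every set `X` of
`n` distinct points whose cycle lies in `W`. -/
def HoldsForVeryGeneralPoints (P : Finset (ProjSpace k N) → Prop) : Prop :=
  ∃ U : ℕ → Set (ZeroCycle k N n),
    (∀ i, IsOpen (U i) ∧ Dense (U i)) ∧
    (∃ (X : Finset (ProjSpace k N)) (hX : X.card = n), ZeroCycle.ofFinset X hX ∈ ⋂ i, U i) ∧
    ∀ (X : Finset (ProjSpace k N)) (hX : X.card = n), ZeroCycle.ofFinset X hX ∈ ⋂ i, U i → P X

end Zariski

section Invariants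

variable {k : Type*} [Field k] {N : ℕ}

/-- The ideal `I(p)` of `k[x_0, …, x_N]` of a point `p` of `ℙ^N`: all polynomials that vanish on
the line of `k^{N+1}` that `p` is. -/
noncomputable def pointIdeal (p : ProjSpace k N) : Ideal (MvPolynomial (Fin (N + 1)) k) :=
  MvPolynomial.vanishingIdeal k (p.submodule : Set (Fin (N + 1) → k))

/-- The multiplicity at `p` of the hypersurface `F = 0`, for a form `F ≠ 0`: the largest `m` with
`F ∈ I(p)^m`. -/
noncomputable def mult (p : ProjSpace k N) (F : MvPolynomial (Fin (N + 1)) k) : ℕ :=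
  sSup {m : ℕ | F ∈ pointIdeal p ^ m}

/-- The defining ideal `I_X` of a finite set of points. -/
noncomputable def setIdeal (X : Finset (ProjSpace k N)) : Ideal (MvPolynomial (Fin (N + 1)) k) :=
  ⨅ p ∈ X, pointIdeal p

/-- The initial degree `α(X)`: the least degree of a nonzero form vanishing on `X`. -/
noncomputable def initialDegree (X : Finset (ProjSpace k N)) : ℕ :=
  sInf {d : ℕ | ∃ F : MvPolynomial (Fin (N + 1)) k,
    F ≠ 0 ∧ F.IsHomogeneous d ∧ F ∈ setIdeal X}

/-- The quotients `deg F / ∑_{p ∈ X} mult_p F`, for all hypersurfaces `F` that pass through at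
least one point of `X`. -/
def seshadriQuotients (X : Finset (ProjSpace k N)) : Set ℝ :=
  {r | ∃ (d : ℕ) (F : MvPolynomial (Fin (N + 1)) k),
    F ≠ 0 ∧ F.IsHomogeneous d ∧ (∃ p ∈ X, F ∈ pointIdeal p) ∧
      r = (d : ℝ) / ((∑ p ∈ X, mult p F : ℕ) : ℝ)}

/-- The multipoint Seshadri constant `ε(N, X)`, the `(N-1)`-st root of the infimum of the quotients
`deg F / ∑_{p ∈ X} mult_p F`. -/
noncomputable def seshadriConstant (X : Finset (ProjSpace k N)) : ℝ :=
  sInf (seshadriQuotients X) ^ (1 / ((N : ℝ) - 1))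

end Invariants

end SeshadriPoints

open MvPolynomial
open scoped Topology

/-! Choose `b` with `(b+N).choose N ≤ n < (b+1+N).choose N`. Counting coefficients gives `α(X) ≤ b +
1` for every `X`, so it suffices that `deg F / ∑ mult_p F ≥ (b+N)/(nN)` for very general `X`. For
each pair `(d, M)` with `nNd < (b+N)M`, a form of degree `d` with multiplicities of sum `M` must be
excluded. This is an open condition on cycles, expressed by nonvanishing minors of matrices of Hasse
derivatives (`noForm_iff_exists_det_ne_zero`). There are countably many pairs, and `(ℙ^N)^n` is
irreducible, so one set of `n` distinct points satisfying all the conditions is enough.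

The special set comes from Schwartz–Zippel with multiplicities (`sum_orders_triangle_le`): on the
triangular grid of size `b` the orders of vanishing of a nonzero `F` add up to at most
`(b+N-1).choose (N-1) * deg F`. The grid has only `(b+N).choose N ≤ n` points and sees only some of
the multiplicities. The remedy is averaging: the Chinese remainder theorem yields integral points
which modulo `n` distinct primes contain the grid under all `n` cyclic relabellings. If for some `m`
of sum `M` a nonzero form existed modulo every one of these primes, summing the `n` grid bounds
would give `(b+N).choose N * M ≤ n * (b+N-1).choose (N-1) * d`, that is, `(b+N)M ≤ nNd`. So for each
`m` some prime excludes the form, and a minor that is nonzero modulo a prime is a nonzero integer,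
hence nonzero in characteristic `0` (`NoForm.of_zmod`). -/

namespace SeshadriPoints

/-! ### Taylor expansion and order of vanishing. -/

section Translate

variable {σ R : Type*} [CommRing R]

/-- The Taylor expansion `F(v + y)` of `F` at `v`, as a polynomial in `y`. -/
noncomputable def taylorAt (v : σ → R) : MvPolynomial σ R →ₐ[R] MvPolynomial σ R :=
  aeval fun j => X j + C (v j)

/-- `F` vanishes to order at least `m` at `v`. -/
def VanishesToOrder (v : σ → R) (m : ℕ) (F : MvPolynomial σ R) : Prop :=
  ∀ γ : σ →₀ ℕ, γ.degree < m → coeff γ (taylorAt v F) = 0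

@[simp] lemma taylorAt_X (v : σ → R) (j : σ) : taylorAt v (X j) = X j + C (v j) := by
  simp [taylorAt]

@[simp] lemma taylorAt_C (v : σ → R) (r : R) : taylorAt v (C r) = C r := by
  simp [taylorAt]

lemma taylorAt_injective (v : σ → R) : Function.Injective (taylorAt v) := by
  have h : (taylorAt (-v)).comp (taylorAt v) = AlgHom.id R _ := by
    ext j
    simp
  intro F G hFG
  have := congrArg (taylorAt (-v)) hFG
  rwa [← AlgHom.comp_apply, ← AlgHom.comp_apply, h] at this

lemma totalDegree_aeval_le {τ : Type*} (f : σ → MvPolynomial τ R)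
    (hf : ∀ i, (f i).totalDegree ≤ 1) (F : MvPolynomial σ R) :
    (aeval f F).totalDegree ≤ F.totalDegree := by
  rw [aeval_def, eval₂_eq]
  refine totalDegree_finsetSum_le fun δ hδ => ?_
  refine (totalDegree_mul _ _).trans ?_
  rw [MvPolynomial.algebraMap_eq, totalDegree_C, zero_add]
  refine (totalDegree_finsetProd _ _).trans ?_
  refine le_trans (Finset.sum_le_sum fun i _ => (totalDegree_pow _ _).trans
    (Nat.mul_le_mul_left _ (hf i))) ?_
  simpa [Finsupp.sum] using le_totalDegree hδ

/-- Translation does not raise the degree, so no Taylor coefficient of order `≥ m` survives either.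
-/
lemma VanishesToOrder.eq_zero_of_totalDegree_lt {v : σ → R} {m : ℕ} {F : MvPolynomial σ R}
    (h : VanishesToOrder v m F) (hm : F.totalDegree < m) : F = 0 := by
  apply taylorAt_injective v
  rw [map_zero]
  ext γ
  rw [coeff_zero]
  by_cases hγ : γ.degree < m
  · exact h γ hγ
  · refine coeff_eq_zero_of_totalDegree_lt (lt_of_le_of_lt (totalDegree_aeval_le _ (fun i => ?_) F)
      (hm.trans_le (not_lt.mp hγ)))
    refine (totalDegree_add _ _).trans ?_
    simp only [totalDegree_C, max_le_iff, zero_le, and_true]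
    exact (totalDegree_monomial_le _ _).trans (by simp)

end Translate

section Linear

variable {σ K : Type*} [Field K]

lemma VanishesToOrder.of_linear_mul_of_eq {v : σ → K} {m : ℕ} {G : MvPolynomial σ K} {j : σ}
    {c : K} (hc : v j = c) (h : VanishesToOrder v m ((X j - C c) * G)) :
    VanishesToOrder v (m - 1) G := by
  intro γ hγ
  have := h (Finsupp.single j 1 + γ) (by rw [map_add, Finsupp.degree_single]; omega)
  simpa [hc, coeff_X_mul] using this

/-- After translation the linear factor is `X j` plus a nonzero constant, a unit among power series;
its inversion is carried out by induction on the order of the coefficient. -/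
lemma VanishesToOrder.of_linear_mul_of_ne {v : σ → K} {m : ℕ} {G : MvPolynomial σ K} {j : σ}
    {c : K} (hc : v j ≠ c) (h : VanishesToOrder v m ((X j - C c) * G)) :
    VanishesToOrder v m G := by
  classical
  intro γ hγ
  induction hr : γ.degree using Nat.strong_induction_on generalizing γ with
  | _ r ih =>
    have h1 := h γ hγ
    have h2 : taylorAt v ((X j - C c) * G) = X j * taylorAt v G + C (v j - c) * taylorAt v G := by
      simp only [map_mul, map_sub, taylorAt_X, taylorAt_C]
      ring
    rw [h2, coeff_add, coeff_C_mul, coeff_X_mul'] at h1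
    split_ifs at h1 with hj
    · have hle : Finsupp.single j 1 ≤ γ := by
        rw [Finsupp.single_le_iff]
        exact Nat.one_le_iff_ne_zero.mpr (Finsupp.mem_support_iff.mp hj)
      have hd : (γ - Finsupp.single j 1).degree + 1 = γ.degree := by
        conv_rhs => rw [← tsub_add_cancel_of_le hle]
        rw [map_add, Finsupp.degree_single]
      rw [ih _ (by omega) _ (by omega) rfl, zero_add] at h1
      exact (mul_eq_zero.mp h1).resolve_left (sub_ne_zero.mpr hc)
    · rw [zero_add] at h1
      exact (mul_eq_zero.mp h1).resolve_left (sub_ne_zero.mpr hc)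

end Linear

/-! ### Restriction to the hyperplanes `x_0 = c`. -/

section Slice

variable {R : Type*} [CommRing R] {N : ℕ}

/-- The restriction of a polynomial to the hyperplane `x_0 = c`. -/
noncomputable def slice (c : R) : MvPolynomial (Fin (N + 1)) R →ₐ[R] MvPolynomial (Fin N) R :=
  aeval (Fin.cons (C c) X : Fin (N + 1) → MvPolynomial (Fin N) R)

lemma slice_eq_eval (c : R) (F : MvPolynomial (Fin (N + 1)) R) :
    slice c F = (finSuccEquiv R N F).eval (C c) := by
  have : (slice c : MvPolynomial (Fin (N + 1)) R →ₐ[R] MvPolynomial (Fin N) R) =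
      ((Polynomial.aeval (R := MvPolynomial (Fin N) R) (C c)).restrictScalars R).comp
        (finSuccEquiv R N).toAlgHom := by
    ext j : 1
    refine Fin.cases ?_ (fun j => ?_) j <;>
      simp [slice, finSuccEquiv_X_zero, finSuccEquiv_X_succ]
  rw [this]
  simp

lemma dvd_of_slice_eq_zero {c : R} {F : MvPolynomial (Fin (N + 1)) R} (h : slice c F = 0) :
    X 0 - C c ∣ F := by
  rw [slice_eq_eval] at h
  obtain ⟨Q, hQ⟩ := Polynomial.dvd_iff_isRoot.mpr h
  refine ⟨(finSuccEquiv R N).symm Q, (finSuccEquiv R N).injective ?_⟩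
  rw [map_mul, AlgEquiv.apply_symm_apply, map_sub, finSuccEquiv_X_zero, hQ]
  congr 2
  exact ((finSuccEquiv R N).commutes c).symm

lemma coeff_slice_zero (F : MvPolynomial (Fin (N + 1)) R) (γ : Fin N →₀ ℕ) :
    coeff γ (slice 0 F) = coeff (γ.cons 0) F := by
  rw [slice_eq_eval, ← finSuccEquiv_coeff_coeff, C_0, Polynomial.coeff_zero_eq_eval_zero]

lemma taylorAt_slice (c : R) (v : Fin N → R) (F : MvPolynomial (Fin (N + 1)) R) :
    taylorAt v (slice c F) = slice 0 (taylorAt (Fin.cons c v : Fin (N + 1) → R) F) := by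
  rw [← AlgHom.comp_apply, ← AlgHom.comp_apply]
  congr 1
  ext j : 1
  refine Fin.cases ?_ (fun j => ?_) j <;> simp [slice, ← MvPolynomial.algebraMap_eq]

lemma VanishesToOrder.slice {c : R} {v : Fin N → R} {m : ℕ} {F : MvPolynomial (Fin (N + 1)) R}
    (h : VanishesToOrder (Fin.cons c v : Fin (N + 1) → R) m F) :
    VanishesToOrder v m (slice c F) := by
  intro γ hγ
  rw [taylorAt_slice, coeff_slice_zero]
  refine h _ ?_
  rwa [Finsupp.degree_eq_sum, Fin.sum_univ_succ, Finsupp.cons_zero, zero_add,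
    Finset.sum_congr rfl (fun i _ => Finsupp.cons_succ i 0 γ), ← Finsupp.degree_eq_sum]

lemma totalDegree_slice_le (c : R) (F : MvPolynomial (Fin (N + 1)) R) :
    (slice c F).totalDegree ≤ F.totalDegree := by
  refine totalDegree_aeval_le _ (fun i => ?_) F
  refine Fin.cases (by simp) (fun j => ?_) i
  exact (totalDegree_monomial_le _ _).trans (by simp)

/-- Dehomogenization merges no two monomials of a form: the degree recovers the exponent of `x_0`
from the others. -/
lemma slice_one_ne_zero {d : ℕ} {F : MvPolynomial (Fin (N + 1)) R} (hF : F ≠ 0)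
    (hd : F.IsHomogeneous d) : slice 1 F ≠ 0 := by
  obtain ⟨δ, hδ⟩ := ne_zero_iff.mp hF
  refine ne_zero_iff.mpr ⟨δ.tail, ?_⟩
  rw [slice_eq_eval, C_1, Polynomial.eval_eq_sum_range]
  simp only [one_pow, mul_one, coeff_sum, finSuccEquiv_coeff_coeff]
  have hdeg : ∀ i, (δ.tail.cons i).degree = i + δ.tail.degree := fun i => by
    rw [Finsupp.degree_eq_sum, Fin.sum_univ_succ, Finsupp.cons_zero, Finsupp.degree_eq_sum]
    simp
  have hδd : δ.degree = d := by
    by_contra h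
    exact hδ (hd.coeff_eq_zero h)
  have hcons : δ.tail.cons (δ 0) = δ := Finsupp.cons_tail δ
  have h0 := hdeg (δ 0)
  rw [hcons] at h0
  rw [Finset.sum_eq_single (δ 0)]
  · rwa [hcons]
  · intro i _ hi
    refine hd.coeff_eq_zero ?_
    rw [hdeg]
    omega
  · intro hi
    rw [Finset.mem_range, not_lt, Nat.succ_le_iff] at hi
    rw [hcons, ← hcons, ← finSuccEquiv_coeff_coeff, Polynomial.coeff_eq_zero_of_natDegree_lt hi,
      coeff_zero]

end Slice

/-! ### Triangular grids and Schwartz–Zippel with multiplicities. -/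

section Grid

/-- The triangular grid `{a ∈ ℕ^N : a_1 + ⋯ + a_N ≤ b}`. -/
def triangle (N b : ℕ) : Finset (Fin N → ℕ) :=
  {a ∈ Fintype.piFinset fun _ => Finset.range (b + 1) | ∑ i, a i ≤ b}

lemma mem_triangle {N b : ℕ} {a : Fin N → ℕ} : a ∈ triangle N b ↔ ∑ i, a i ≤ b := by
  simp only [triangle, Finset.mem_filter, Fintype.mem_piFinset, Finset.mem_range,
    Nat.lt_succ_iff, and_iff_right_iff_imp]
  exact fun h i => (Finset.single_le_sum (fun _ _ => Nat.zero_le _) (Finset.mem_univ i)).trans h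

lemma le_of_mem_triangle {N b : ℕ} {a : Fin N → ℕ} (ha : a ∈ triangle N b) (i : Fin N) :
    a i ≤ b :=
  (Finset.single_le_sum (fun _ _ => Nat.zero_le _) (Finset.mem_univ i)).trans (mem_triangle.mp ha)

lemma cons_mem_triangle {N b j : ℕ} {a : Fin N → ℕ} (hj : j ≤ b) :
    (Fin.cons j a : Fin (N + 1) → ℕ) ∈ triangle (N + 1) b ↔ a ∈ triangle N (b - j) := by
  simp only [mem_triangle, Fin.sum_univ_succ, Fin.cons_zero, Fin.cons_succ]
  omega

lemma sum_triangle_succ (N b : ℕ) (f : (Fin (N + 1) → ℕ) → ℕ) :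
    ∑ a ∈ triangle (N + 1) b, f a =
      ∑ j ∈ Finset.range (b + 1), ∑ a ∈ triangle N (b - j), f (Fin.cons j a) := by
  rw [Finset.sum_sigma']
  refine Finset.sum_bij' (fun a _ => ⟨a 0, Fin.tail a⟩) (fun p _ => Fin.cons p.1 p.2) ?_ ?_ ?_ ?_ ?_
  · intro a ha
    have h0 := le_of_mem_triangle ha 0
    rw [Finset.mem_sigma, Finset.mem_range, ← cons_mem_triangle h0, Fin.cons_self_tail]
    exact ⟨Nat.lt_succ_iff.mpr h0, ha⟩
  · rintro ⟨j, a⟩ h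
    rw [Finset.mem_sigma, Finset.mem_range] at h
    exact (cons_mem_triangle (by have := h.1; dsimp only at this; omega)).mpr h.2
  · intro a _
    exact Fin.cons_self_tail a
  · rintro ⟨j, a⟩ _
    rfl
  · intro a _
    rw [Fin.cons_self_tail]

lemma sum_range_choose_sub (N b : ℕ) :
    ∑ j ∈ Finset.range (b + 1), (b - j + N).choose N = (b + N + 1).choose (N + 1) := by
  rw [Finset.sum_range_reflect (fun i => (i + N).choose N) (b + 1) |>.symm.trans
    (Finset.sum_congr rfl fun j _ => by rw [Nat.add_sub_cancel]) |>.symm]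
  exact Nat.sum_range_add_choose b N

lemma card_triangle (N b : ℕ) : (triangle N b).card = (b + N).choose N := by
  induction N generalizing b with
  | zero =>
    rw [Nat.choose_zero_right, Finset.card_eq_one]
    exact ⟨0, by ext a; simp [mem_triangle, Subsingleton.elim a 0]⟩
  | succ N ih =>
    rw [Finset.card_eq_sum_ones, sum_triangle_succ]
    simp only [← Finset.card_eq_sum_ones, ih]
    exact sum_range_choose_sub N b

lemma card_filter_triangle_le (N b j : ℕ) :
    ({a ∈ triangle (N + 1) b | a 0 = j} : Finset _).card ≤ (b + N).choose N := by
  rw [← card_triangle]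
  refine Finset.card_le_card_of_injOn Fin.tail ?_ ?_
  · intro a ha
    have h := mem_triangle.mp (Finset.mem_filter.mp ha).1
    rw [Fin.sum_univ_succ] at h
    exact mem_triangle.mpr (le_trans (Nat.le_add_left _ _) h)
  · intro a ha a' ha' h
    rw [← Fin.cons_self_tail a, ← Fin.cons_self_tail a', h, (Finset.mem_filter.mp ha).2,
      (Finset.mem_filter.mp ha').2]

/-- The Schwartz–Zippel constant of the triangular grid. -/
def triangleConst : ℕ → ℕ → ℕ
  | 0, _ => 0
  | N + 1, b => (b + N).choose N

lemma sum_triangleConst_le (N b : ℕ) :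
    ∑ j ∈ Finset.range (b + 1), triangleConst N (b - j) ≤ triangleConst (N + 1) b := by
  cases N with
  | zero => simp [triangleConst]
  | succ N => exact (sum_range_choose_sub N b).le

/-- Schwartz–Zippel with multiplicities on a triangular grid. -/
theorem sum_orders_triangle_le {K : Type*} [Field K] (N b d : ℕ)
    (hb : ∀ i j : ℕ, i ≤ b → j ≤ b → (i : K) = j → i = j)
    (F : MvPolynomial (Fin N) K) (hF : F ≠ 0) (hd : F.totalDegree ≤ d) (m : (Fin N → ℕ) → ℕ)
    (hm : ∀ a ∈ triangle N b, VanishesToOrder (fun i => (a i : K)) (m a) F) :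
    ∑ a ∈ triangle N b, m a ≤ triangleConst N b * d := by
  induction N generalizing b d with
  | zero =>
    -- Without variables `F` is a nonzero constant, so every order is `0`; this is why the constant
    -- is `0` here.
    rw [triangleConst, zero_mul, Nat.le_zero, Finset.sum_eq_zero_iff]
    intro a ha
    by_contra h0
    refine hF ((hm a ha).eq_zero_of_totalDegree_lt ?_)
    rw [eq_C_of_isEmpty F, totalDegree_C]
    omega
  | succ N ih =>
    induction d generalizing F m with
    | zero =>
      refine le_of_eq ?_
      rw [mul_zero, Finset.sum_eq_zero_iff]
      intro a ha
      by_contra h0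
      exact hF ((hm a ha).eq_zero_of_totalDegree_lt (by omega))
    | succ d ihd =>
      -- If `F` vanishes on a hyperplane `x_0 = j` of the grid, divide by `x_0 - j`: the degree
      -- drops by one, and orders drop, by one, only at the grid points on that hyperplane, of which
      -- there are at most `triangleConst (N + 1) b`. Otherwise every slice is nonzero, and
      -- induction on `N` applies to the triangles of size `b - j`, whose constants are added up.
      by_cases hex : ∃ j ≤ b, slice (j : K) F = 0
      · obtain ⟨j, hj, hs⟩ := hex
        obtain ⟨G, rfl⟩ := dvd_of_slice_eq_zero hs
        have hG : G ≠ 0 := right_ne_zero_of_mul hF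
        have hL : (X 0 - C (j : K) : MvPolynomial (Fin (N + 1)) K) ≠ 0 := left_ne_zero_of_mul hF
        have hLdeg : 1 ≤ (X 0 - C (j : K) : MvPolynomial (Fin (N + 1)) K).totalDegree := by
          refine le_trans ?_ (le_totalDegree (s := Finsupp.single 0 1) ?_)
          · simp
          · rw [mem_support_iff, coeff_sub, coeff_X, coeff_C,
              if_neg (Finsupp.single_ne_zero.mpr one_ne_zero).symm]
            simp
        rw [totalDegree_mul_of_isDomain hL hG] at hd
        have key := ihd G hG (by omega) (fun a => if a 0 = j then m a - 1 else m a) (by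
          intro a ha
          by_cases h0 : a 0 = j
          · rw [if_pos h0]
            exact (hm a ha).of_linear_mul_of_eq (by rw [h0])
          · rw [if_neg h0]
            exact (hm a ha).of_linear_mul_of_ne
              fun h => h0 (hb _ _ (le_of_mem_triangle ha 0) hj h))
        calc ∑ a ∈ triangle (N + 1) b, m a
            ≤ ∑ a ∈ triangle (N + 1) b,
                ((if a 0 = j then m a - 1 else m a) + if a 0 = j then 1 else 0) :=
              Finset.sum_le_sum fun a _ => by split_ifs <;> omega
          _ ≤ triangleConst (N + 1) b * d + triangleConst (N + 1) b := by
              rw [Finset.sum_add_distrib, ← Finset.card_filter]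
              exact add_le_add key (card_filter_triangle_le N b j)
          _ = _ := by ring
      · push Not at hex
        rw [sum_triangle_succ]
        calc _ ≤ ∑ j ∈ Finset.range (b + 1), triangleConst N (b - j) * (d + 1) := by
              refine Finset.sum_le_sum fun j hj => ?_
              have hjb : j ≤ b := Nat.lt_succ_iff.mp (Finset.mem_range.mp hj)
              refine ih (b - j) (d + 1) (fun i i' hi hi' => hb i i' (by omega) (by omega))
                (slice (j : K) F) (hex j hjb) ((totalDegree_slice_le _ _).trans hd) _ ?_
              intro a ha
              refine VanishesToOrder.slice ?_
              have := hm _ ((cons_mem_triangle hjb).mpr ha)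
              convert this using 1
              ext i
              refine Fin.cases ?_ (fun i => ?_) i <;> simp
          _ ≤ _ := by
              rw [← Finset.sum_mul]
              exact Nat.mul_le_mul_right _ (sum_triangleConst_le N b)

end Grid

/-! ### Hasse derivatives and the linear conditions imposed by multiplicities. -/

section Hasse

variable {σ R : Type*} [Fintype σ] [CommRing R]

/-- The value at `v` of the Hasse derivative of order `γ` of the monomial with exponent `δ`. -/
def hasse (γ δ : σ →₀ ℕ) (v : σ → R) : R :=
  ∏ j, ((δ j).choose (γ j) : R) * v j ^ (δ j - γ j)

lemma map_hasse {S : Type*} [CommRing S] (f : R →+* S) (γ δ : σ →₀ ℕ) (v : σ → R) :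
    f (hasse γ δ v) = hasse γ δ (fun j => f (v j)) := by
  simp [hasse]

lemma coeff_taylorAt_monomial (v : σ → R) (γ δ : σ →₀ ℕ) (r : R) :
    coeff γ (taylorAt v (monomial δ r)) = r * hasse γ δ v := by
  classical
  have h1 : taylorAt v (monomial δ r) = C r * ∏ j, (X j + C (v j)) ^ δ j := by
    rw [taylorAt, aeval_monomial, Finsupp.prod_fintype _ _ (by simp)]
    rfl
  have h2 : ∀ x : σ → ℕ, ∏ j, (X j ^ x j * C (v j) ^ (δ j - x j) * ((δ j).choose (x j) :
      MvPolynomial σ R)) = monomial (Finsupp.equivFunOnFinite.symm x)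
        (hasse (Finsupp.equivFunOnFinite.symm x) δ v) := by
    intro x
    rw [monomial_eq, Finsupp.prod_fintype _ _ (by simp), hasse, map_prod, ← Finset.prod_mul_distrib]
    refine Finset.prod_congr rfl fun j _ => ?_
    simp only [map_mul, map_natCast, map_pow, Finsupp.equivFunOnFinite_symm_apply_apply]
    ring
  rw [h1, coeff_C_mul]
  congr 1
  simp only [add_pow]
  rw [Finset.prod_univ_sum]
  simp only [h2, coeff_sum, coeff_monomial]
  have hγ : ∀ x : σ → ℕ, Finsupp.equivFunOnFinite.symm x = γ ↔ x = γ := fun x => by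
    rw [Equiv.symm_apply_eq]
    rfl
  simp only [hγ]
  by_cases hle : ∀ j, γ j ≤ δ j
  · rw [Finset.sum_eq_single (γ : σ → ℕ)]
    · rw [if_pos rfl]
      rw [(hγ γ).mpr rfl]
    · intro x _ hx
      rw [if_neg hx]
    · intro h
      refine absurd (Fintype.mem_piFinset.mpr fun j => ?_) h
      exact Finset.mem_range.mpr (Nat.lt_succ_of_le (hle j))
  · push Not at hle
    obtain ⟨j, hj⟩ := hle
    rw [Finset.sum_eq_zero, hasse, Finset.prod_eq_zero (Finset.mem_univ j)]
    · rw [Nat.choose_eq_zero_of_lt hj, Nat.cast_zero, zero_mul]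
    · intro x hx
      rw [if_neg]
      rintro rfl
      have := Finset.mem_range.mp (Fintype.mem_piFinset.mp hx j)
      omega

variable [DecidableEq σ]

variable (σ) in
/-- The exponents of the monomials of degree `d`. -/
abbrev Exponent (d : ℕ) : Type _ := (Finset.univ : Finset σ).finsuppAntidiag d

lemma mem_finsuppAntidiag_univ {d : ℕ} {δ : σ →₀ ℕ} :
    δ ∈ (Finset.univ : Finset σ).finsuppAntidiag d ↔ δ.degree = d := by
  simp [Finset.mem_finsuppAntidiag, Finsupp.degree_eq_sum]

/-- The form of degree `d` with coefficients `c`. -/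
noncomputable def formOfCoeffs {d : ℕ} (c : Exponent σ d → R) : MvPolynomial σ R :=
  ∑ δ, monomial δ.1 (c δ)

lemma coeff_formOfCoeffs {d : ℕ} (c : Exponent σ d → R) (δ : Exponent σ d) :
    coeff δ.1 (formOfCoeffs c) = c δ := by
  rw [formOfCoeffs, coeff_sum, Finset.sum_eq_single δ]
  · rw [coeff_monomial, if_pos rfl]
  · intro δ' _ h
    rw [coeff_monomial, if_neg (fun h' => h (Subtype.ext h'))]
  · exact fun h => absurd (Finset.mem_univ _) h

lemma isHomogeneous_formOfCoeffs {d : ℕ} (c : Exponent σ d → R) :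
    (formOfCoeffs c).IsHomogeneous d :=
  IsHomogeneous.sum _ _ _ fun δ _ =>
    isHomogeneous_monomial _ (mem_finsuppAntidiag_univ.mp δ.2)

lemma _root_.MvPolynomial.IsHomogeneous.eq_formOfCoeffs {d : ℕ} {F : MvPolynomial σ R}
    (hF : F.IsHomogeneous d) : F = formOfCoeffs fun δ : Exponent σ d => coeff δ.1 F := by
  ext δ
  by_cases h : δ.degree = d
  · exact (coeff_formOfCoeffs (fun δ : Exponent σ d => coeff δ.1 F)
      ⟨δ, mem_finsuppAntidiag_univ.mpr h⟩).symm
  · rw [hF.coeff_eq_zero h, (isHomogeneous_formOfCoeffs _).coeff_eq_zero h]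

lemma coeff_taylorAt_formOfCoeffs {d : ℕ} (v : σ → R) (γ : σ →₀ ℕ) (c : Exponent σ d → R) :
    coeff γ (taylorAt v (formOfCoeffs c)) = ∑ δ, hasse γ δ.1 v * c δ := by
  rw [formOfCoeffs, map_sum, coeff_sum]
  refine Finset.sum_congr rfl fun δ _ => ?_
  rw [coeff_taylorAt_monomial, mul_comm]

/-- There is no nonzero form of degree `d` that vanishes to order at least `m i` at `v i` for
all `i`. -/
def NoForm {ι : Type*} (v : ι → σ → R) (d : ℕ) (m : ι → ℕ) : Prop :=
  ∀ F : MvPolynomial σ R, F.IsHomogeneous d → (∀ i, VanishesToOrder (v i) (m i) F) → F = 0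

/-- The square matrix of Hasse derivatives of the monomials of degree `d` given by a choice `ρ` of
points and orders. -/
def hasseMatrix {ι : Type*} {d : ℕ} (v : ι → σ → R) (ρ : Exponent σ d → ι × (σ →₀ ℕ)) :
    Matrix (Exponent σ d) (Exponent σ d) R :=
  Matrix.of fun r δ => hasse (ρ r).2 δ.1 (v (ρ r).1)

lemma map_det_hasseMatrix {S ι : Type*} [CommRing S] (f : R →+* S) {d : ℕ} (v : ι → σ → R)
    (ρ : Exponent σ d → ι × (σ →₀ ℕ)) :
    f (hasseMatrix v ρ).det = (hasseMatrix (fun i j => f (v i j)) ρ).det := by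
  rw [RingHom.map_det]
  congr 1
  ext r δ
  exact map_hasse f _ _ _

end Hasse

/-- Rows without a common nonzero solution span the dual space, since a proper subspace lies in the
kernel of a nonzero functional. A basis chosen among the rows gives the minor. -/
lemma exists_det_ne_zero_of_forall_eq_zero {K ι κ : Type*} [Field K] [Fintype κ] [DecidableEq κ]
    (A : ι → κ → K) (I : Set ι)
    (h : ∀ c : κ → K, (∀ r ∈ I, ∑ j, A r j * c j = 0) → c = 0) :
    ∃ ρ : κ → ι, (∀ j, ρ j ∈ I) ∧ (Matrix.of fun j j' => A (ρ j) j').det ≠ 0 := by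
  have hspan : Submodule.span K (A '' I) = ⊤ := by
    by_contra hne
    obtain ⟨f, hf, hle⟩ := Submodule.exists_le_ker_of_lt_top _ (lt_top_iff_ne_top.mpr hne)
    have hfc : ∀ x, f x = ∑ j, x j * f (Pi.single j 1) := fun x => by
      conv_lhs => rw [pi_eq_sum_univ' x]
      rw [map_sum]
      refine Finset.sum_congr rfl fun j _ => ?_
      rw [map_smul, smul_eq_mul]
    have h0 := h (fun j => f (Pi.single j 1)) fun r hr => by
      rw [← hfc]
      exact hle (Submodule.subset_span ⟨r, hr, rfl⟩)
    refine hf (LinearMap.ext fun x => ?_)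
    rw [hfc]
    exact Finset.sum_eq_zero fun j _ => by rw [congrFun h0 j, Pi.zero_apply, mul_zero]
  obtain ⟨b, hb, hbs, hli⟩ := exists_linearIndependent K (A '' I)
  rw [hspan] at hbs
  let B : Module.Basis b K (κ → K) := Module.Basis.mk hli (by rw [Subtype.range_coe, hbs])
  let e : κ ≃ b := (Pi.basisFun K κ).indexEquiv B
  choose ρ hρ hρA using fun j => hb (e j).2
  refine ⟨ρ, hρ, ?_⟩
  have hli' : LinearIndependent K (Matrix.of fun j j' => A (ρ j) j').row := by
    have : (Matrix.of fun j j' => A (ρ j) j').row = (fun x : b => (x : κ → K)) ∘ e := by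
      ext j : 1
      exact hρA j
    rw [this]
    exact hli.comp e e.injective
  exact ((Matrix.isUnit_iff_isUnit_det _).mp
    (Matrix.linearIndependent_rows_iff_isUnit.mp hli')).ne_zero

/-! ### Nonexistence of forms as a condition on minors. -/

section NoForm

variable {σ K ι : Type*} [Fintype σ] [DecidableEq σ] [Field K]

lemma noForm_iff_exists_det_ne_zero {v : ι → σ → K} {d : ℕ} {m : ι → ℕ} :
    NoForm v d m ↔ ∃ ρ : Exponent σ d → ι × (σ →₀ ℕ),
      (∀ r, (ρ r).2.degree < m (ρ r).1) ∧ (hasseMatrix v ρ).det ≠ 0 := by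
  constructor
  · intro h
    refine exists_det_ne_zero_of_forall_eq_zero
      (fun (q : ι × (σ →₀ ℕ)) (δ : Exponent σ d) => hasse q.2 δ.1 (v q.1))
      {q | q.2.degree < m q.1} fun c hc => ?_
    have h0 := h (formOfCoeffs c) (isHomogeneous_formOfCoeffs c) fun i γ hγ => by
      rw [coeff_taylorAt_formOfCoeffs]
      exact hc (i, γ) hγ
    ext δ
    rw [← coeff_formOfCoeffs c δ, h0, coeff_zero, Pi.zero_apply]
  · rintro ⟨ρ, hρ, hdet⟩ F hF hv
    have h0 : (fun δ : Exponent σ d => coeff δ.1 F) = 0 := by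
      refine Matrix.eq_zero_of_mulVec_eq_zero hdet ?_
      ext r
      have := hv (ρ r).1 (ρ r).2 (hρ r)
      rw [hF.eq_formOfCoeffs, coeff_taylorAt_formOfCoeffs] at this
      exact this
    rw [hF.eq_formOfCoeffs, h0]
    simp [formOfCoeffs]

omit [Fintype σ] [DecidableEq σ] in
lemma NoForm.of_perm {v : ι → σ → K} {d : ℕ} {m : ι → ℕ} (e : Equiv.Perm ι)
    (h : NoForm v d (m ∘ e.symm)) : NoForm (v ∘ e) d m := by
  intro F hF hv
  refine h F hF fun i => ?_
  simpa using hv (e.symm i)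

/-- Nonexistence of forms lifts from a prime field to characteristic zero. -/
lemma NoForm.of_zmod {k : Type*} [Field k] [CharZero k] {p : ℕ} [Fact p.Prime] {v : ι → σ → ℤ}
    {d : ℕ} {m : ι → ℕ} (h : NoForm (fun i j => (v i j : ZMod p)) d m) :
    NoForm (fun i j => (v i j : k)) d m := by
  rw [noForm_iff_exists_det_ne_zero] at h ⊢
  obtain ⟨ρ, hρ, hdet⟩ := h
  refine ⟨ρ, hρ, ?_⟩
  -- Both determinants are images of the same integer, so nonvanishing modulo `p` passes to `ℤ` and
  -- then to `k`.
  have h1 := map_det_hasseMatrix (Int.castRingHom (ZMod p)) v ρ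
  have h2 := map_det_hasseMatrix (Int.castRingHom k) v ρ
  simp only [eq_intCast] at h1 h2
  rw [← h2, Int.cast_ne_zero]
  rw [← h1] at hdet
  rintro h0
  exact hdet (by rw [h0, Int.cast_zero])

end NoForm

/-! ### Multiplicities at points, and forms through given points. -/

section PointIdeal

variable {k : Type*} [Field k] {N : ℕ}

lemma constantCoeff_taylorAt {σ R : Type*} [CommRing R] (v : σ → R) (F : MvPolynomial σ R) :
    constantCoeff (taylorAt v F) = eval v F := by
  have : (constantCoeff (R := R) (σ := σ)).comp (taylorAt v : _ →+* MvPolynomial σ R) = eval v := by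
    ext <;> simp
  exact RingHom.congr_fun this F

/-- Translation by a representative carries `I(p)` into the ideal of the variables, hence powers
into powers. Only this implication is needed, as multiplicities are to be bounded from above. -/
lemma vanishesToOrder_of_mem_pointIdeal_pow {p : ProjSpace k N} {m : ℕ}
    {F : MvPolynomial (Fin (N + 1)) k} (h : F ∈ pointIdeal p ^ m) :
    VanishesToOrder p.rep m F := by
  have hle : pointIdeal p ≤ (idealOfVars (Fin (N + 1)) k).comap (taylorAt p.rep) := by
    intro G hG
    have h0 : eval p.rep G = 0 := hG _ (by
      rw [Projectivization.submodule_eq]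
      exact Submodule.mem_span_singleton_self _)
    rw [Ideal.mem_comap, ← pow_one (idealOfVars _ _), mem_pow_idealOfVars_iff']
    intro γ hγ
    rw [Nat.lt_one_iff, Finsupp.degree_eq_zero_iff] at hγ
    rw [hγ, ← constantCoeff_eq, constantCoeff_taylorAt, h0]
  have h1 : taylorAt p.rep F ∈ idealOfVars (Fin (N + 1)) k ^ m := by
    have := Ideal.mem_map_of_mem (taylorAt p.rep) h
    rw [Ideal.map_pow] at this
    exact Ideal.pow_right_mono (Ideal.map_le_iff_le_comap.mpr hle) m this
  exact (mem_pow_idealOfVars_iff' _ _).mp h1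

lemma bddAbove_setOf_mem_pointIdeal_pow {F : MvPolynomial (Fin (N + 1)) k} (hF : F ≠ 0)
    (p : ProjSpace k N) : BddAbove {m : ℕ | F ∈ pointIdeal p ^ m} := by
  refine ⟨F.totalDegree, fun m hm => ?_⟩
  by_contra h
  exact hF ((vanishesToOrder_of_mem_pointIdeal_pow hm).eq_zero_of_totalDegree_lt (not_le.mp h))

lemma mem_pointIdeal_pow_mult {F : MvPolynomial (Fin (N + 1)) k} (hF : F ≠ 0)
    (p : ProjSpace k N) : F ∈ pointIdeal p ^ mult p F :=
  Nat.sSup_mem (s := {m : ℕ | F ∈ pointIdeal p ^ m}) ⟨0, by simp⟩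
    (bddAbove_setOf_mem_pointIdeal_pow hF p)

lemma one_le_mult {F : MvPolynomial (Fin (N + 1)) k} (hF : F ≠ 0) {p : ProjSpace k N}
    (hp : F ∈ pointIdeal p) : 1 ≤ mult p F :=
  le_csSup (bddAbove_setOf_mem_pointIdeal_pow hF p) (by simpa using hp)

lemma eval_smul_of_isHomogeneous {σ R : Type*} [Fintype σ] [CommRing R] {d : ℕ}
    {F : MvPolynomial σ R} (hF : F.IsHomogeneous d) (c : R) (x : σ → R) :
    eval (c • x) F = c ^ d * eval x F := by
  rw [eval_eq', eval_eq', Finset.mul_sum]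
  refine Finset.sum_congr rfl fun δ hδ => ?_
  have hd : δ.degree = d := by
    by_contra h
    exact mem_support_iff.mp hδ (hF.coeff_eq_zero h)
  simp only [Pi.smul_apply, smul_eq_mul, mul_pow, Finset.prod_mul_distrib, Finset.prod_pow_eq_pow_sum]
  rw [← Finsupp.degree_eq_sum, hd]
  ring

lemma mem_pointIdeal_of_eval_rep_eq_zero {F : MvPolynomial (Fin (N + 1)) k} {d : ℕ}
    (hF : F.IsHomogeneous d) {p : ProjSpace k N} (h : eval p.rep F = 0) : F ∈ pointIdeal p := by
  intro x hx
  rw [SetLike.mem_coe, Projectivization.submodule_eq] at hx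
  obtain ⟨c, rfl⟩ := Submodule.mem_span_singleton.mp hx
  rw [aeval_eq_eval]
  exact (eval_smul_of_isHomogeneous hF c p.rep).trans (by rw [h, mul_zero])

/-- Through any `n` points there is a hypersurface of each degree `d` with
`n < (N + d).choose N`. -/
lemma exists_form_mem_setIdeal {d : ℕ} (X : Finset (ProjSpace k N))
    (hd : X.card < (d + N).choose N) :
    ∃ F : MvPolynomial (Fin (N + 1)) k, F ≠ 0 ∧ F.IsHomogeneous d ∧ F ∈ setIdeal X := by
  let φ : (Exponent (Fin (N + 1)) d → k) →ₗ[k] (X → k) :=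
    { toFun := fun c p => eval p.1.rep (formOfCoeffs c)
      map_add' := fun c c' => by
        ext p
        simp [formOfCoeffs, Finset.sum_add_distrib]
      map_smul' := fun r c => by
        ext p
        simp [formOfCoeffs, Finset.mul_sum, eval_monomial, mul_assoc] }
  have hlt : Module.finrank k (X → k) < Module.finrank k (Exponent (Fin (N + 1)) d → k) := by
    rw [Module.finrank_fintype_fun_eq_card, Module.finrank_fintype_fun_eq_card, Fintype.card_coe,
      Fintype.card_coe, Finset.card_finsuppAntidiag_nat_eq_choose]
    simpa [add_comm, ← Nat.choose_symm_add] using hd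
  obtain ⟨c, hc, hc0⟩ := (Submodule.ne_bot_iff _).mp (LinearMap.ker_ne_bot_of_finrank_lt (f := φ) hlt)
  refine ⟨formOfCoeffs c, fun h0 => hc0 ?_, isHomogeneous_formOfCoeffs c, ?_⟩
  · ext δ
    rw [← coeff_formOfCoeffs c δ, h0, coeff_zero, Pi.zero_apply]
  · rw [setIdeal, Ideal.mem_iInf]
    intro p
    rw [Ideal.mem_iInf]
    intro hp
    exact mem_pointIdeal_of_eval_rep_eq_zero (isHomogeneous_formOfCoeffs c)
      (congrFun (LinearMap.mem_ker.mp hc) ⟨p, hp⟩)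

end PointIdeal

/-! ### Multihomogeneity of the minors. -/

section Multihomogeneous

variable {k : Type*} [Field k] {N n : ℕ}

lemma IsMultihomogeneous.mul {f g : MvPolynomial (Fin n × Fin (N + 1)) k} {d e : Fin n → ℕ}
    (hf : IsMultihomogeneous k N n f d) (hg : IsMultihomogeneous k N n g e) :
    IsMultihomogeneous k N n (f * g) (d + e) :=
  IsWeightedHomogeneous.mul hf hg

lemma IsMultihomogeneous.eval_smul {f : MvPolynomial (Fin n × Fin (N + 1)) k} {d : Fin n → ℕ}
    (hf : IsMultihomogeneous k N n f d) (c : Fin n → k) (x : Fin n → Fin (N + 1) → k) :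
    eval (fun ij => (c ij.1 • x ij.1) ij.2) f =
      (∏ i, c i ^ d i) * eval (fun ij => x ij.1 ij.2) f := by
  rw [eval_eq', eval_eq', Finset.mul_sum]
  refine Finset.sum_congr rfl fun δ hδ => ?_
  have hd : ∀ i, d i = ∑ j, δ (i, j) := fun i => by
    rw [← hf (mem_support_iff.mp hδ), Finsupp.weight_apply, Finsupp.sum_fintype _ _ (by simp),
      Finset.sum_apply, Fintype.sum_prod_type, Finset.sum_eq_single i]
    · simp
    · intro i' _ hi'
      exact Finset.sum_eq_zero fun j _ => by simp [Pi.single_eq_of_ne hi'.symm]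
    · simp
  simp only [Pi.smul_apply, smul_eq_mul, mul_pow, Finset.prod_mul_distrib]
  rw [Fintype.prod_prod_type (f := fun ij : Fin n × Fin (N + 1) => c ij.1 ^ δ ij)]
  simp only [Finset.prod_pow_eq_pow_sum, hd]
  ring

lemma isMultihomogeneous_hasse (γ δ : Fin (N + 1) →₀ ℕ) (i : Fin n) :
    IsMultihomogeneous k N n (hasse γ δ fun j => X (i, j)) (Pi.single i (δ.degree - γ.degree)) := by
  by_cases h : γ ≤ δ
  · have hdeg : (Pi.single i (δ.degree - γ.degree) : Fin n → ℕ) =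
        ∑ j, (δ j - γ j) • (Pi.single i 1 : Fin n → ℕ) := by
      rw [← Finset.sum_smul]
      have h1 : (δ - γ).degree + γ.degree = δ.degree := by
        rw [← map_add, tsub_add_cancel_of_le h]
      have h2 : (δ - γ).degree = ∑ j, (δ j - γ j) := by
        rw [Finsupp.degree_eq_sum]
        rfl
      rw [← h2, ← h1, Nat.add_sub_cancel, ← Pi.single_smul, smul_eq_mul, mul_one]
    rw [hdeg]
    refine IsWeightedHomogeneous.prod _ _ _ fun j _ => ?_
    rw [← map_natCast (C : k →+* MvPolynomial (Fin n × Fin (N + 1)) k)]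
    exact ((isWeightedHomogeneous_X k _ (i, j)).pow _).C_mul _
  · have h0 : hasse γ δ (fun j => (X (i, j) : MvPolynomial (Fin n × Fin (N + 1)) k)) = 0 := by
      obtain ⟨j, hj⟩ : ∃ j, δ j < γ j := by
        by_contra h'
        push Not at h'
        exact h h'
      rw [hasse, Finset.prod_eq_zero (Finset.mem_univ j)]
      rw [Nat.choose_eq_zero_of_lt hj, Nat.cast_zero, zero_mul]
    rw [h0]
    exact isWeightedHomogeneous_zero _ _ _

variable (k) in
/-- The minor of the universal matrix of Hasse derivatives given by `ρ`. -/
noncomputable def hasseMinor {d : ℕ} (ρ : Exponent (Fin (N + 1)) d → Fin n × (Fin (N + 1) →₀ ℕ)) :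
    MvPolynomial (Fin n × Fin (N + 1)) k :=
  (hasseMatrix (fun i j => X (i, j)) ρ).det

lemma eval_hasseMinor {d : ℕ} (ρ : Exponent (Fin (N + 1)) d → Fin n × (Fin (N + 1) →₀ ℕ))
    (x : Fin n → Fin (N + 1) → k) :
    eval (fun ij => x ij.1 ij.2) (hasseMinor k ρ) = (hasseMatrix x ρ).det := by
  rw [hasseMinor, map_det_hasseMatrix]
  simp only [eval_X]

/-- All entries of the row of a point `i` and an order `γ` have the same multidegree, `d - γ.degree`
in the variables of `i`, so all terms of the determinant do too. Hence the nonvanishing locus of a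
minor is a basic open set. -/
lemma isMultihomogeneous_hasseMinor {d : ℕ}
    (ρ : Exponent (Fin (N + 1)) d → Fin n × (Fin (N + 1) →₀ ℕ)) :
    IsMultihomogeneous k N n (hasseMinor k ρ)
      (∑ r, Pi.single (ρ r).1 (d - (ρ r).2.degree)) := by
  rw [hasseMinor, Matrix.det_apply']
  refine IsWeightedHomogeneous.sum _ _ _ fun σ _ => ?_
  rw [← map_intCast (C : k →+* MvPolynomial (Fin n × Fin (N + 1)) k)]
  refine IsWeightedHomogeneous.C_mul ?_ _
  rw [← Equiv.sum_comp σ]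
  refine IsWeightedHomogeneous.prod _ _ _ fun r _ => ?_
  have := isMultihomogeneous_hasse (k := k) (ρ (σ r)).2 r.1 (ρ (σ r)).1
  rwa [mem_finsuppAntidiag_univ.mp r.2] at this

lemma NoForm.smul {x : Fin n → Fin (N + 1) → k} {d : ℕ} {m : Fin n → ℕ} (h : NoForm x d m)
    (c : Fin n → k) (hc : ∀ i, c i ≠ 0) : NoForm (fun i => c i • x i) d m := by
  rw [noForm_iff_exists_det_ne_zero] at h ⊢
  obtain ⟨ρ, hρ, hdet⟩ := h
  refine ⟨ρ, hρ, ?_⟩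
  rw [← eval_hasseMinor, (isMultihomogeneous_hasseMinor ρ).eval_smul, eval_hasseMinor]
  exact mul_ne_zero (Finset.prod_ne_zero_iff.mpr fun i _ => pow_ne_zero _ (hc i)) hdet

end Multihomogeneous

/-! ### The Zariski topology on `(ℙ^N)^n`. -/

section Zariski

variable {k : Type*} [Field k] {N n : ℕ}

lemma isOpen_setOf_noForm (d : ℕ) (m : Fin n → ℕ) :
    IsOpen[zariskiTopology k N n] {p | NoForm (fun i => (p i).rep) d m} := by
  let _ := zariskiTopology k N n
  have : {p : Fin n → ProjSpace k N | NoForm (fun i => (p i).rep) d m} =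
      ⋃ ρ ∈ {ρ : Exponent (Fin (N + 1)) d → Fin n × (Fin (N + 1) →₀ ℕ) |
        ∀ r, (ρ r).2.degree < m (ρ r).1}, nonvanishingLocus k N n (hasseMinor k ρ) := by
    ext p
    rw [Set.mem_ofPred_eq, noForm_iff_exists_det_ne_zero]
    simp only [Set.mem_ofPred_eq, Set.mem_iUnion, exists_prop, nonvanishingLocus]
    refine exists_congr fun ρ => and_congr_right fun _ => ?_
    rw [← eval_hasseMinor]
  rw [this]
  exact isOpen_biUnion fun ρ _ =>
    TopologicalSpace.isOpen_generateFrom_of_mem ⟨_, _, isMultihomogeneous_hasseMinor ρ, rfl⟩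

lemma exists_nonvanishingLocus_subset {V : Set (Fin n → ProjSpace k N)}
    (hV : IsOpen[zariskiTopology k N n] V) {p : Fin n → ProjSpace k N} (hp : p ∈ V) :
    ∃ f d, IsMultihomogeneous k N n f d ∧ p ∈ nonvanishingLocus k N n f ∧
      nonvanishingLocus k N n f ⊆ V := by
  induction hV with
  | basic V hV =>
    obtain ⟨f, d, hf, rfl⟩ := hV
    exact ⟨f, d, hf, hp, subset_rfl⟩
  | univ =>
    exact ⟨1, 0, isWeightedHomogeneous_one _ _, by simp [nonvanishingLocus], Set.subset_univ _⟩
  | inter V V' _ _ ih ih' =>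
    obtain ⟨f, d, hf, hpf, hfV⟩ := ih hp.1
    obtain ⟨g, e, hg, hpg, hgV⟩ := ih' hp.2
    refine ⟨f * g, d + e, hf.mul hg, ?_, fun q hq => ?_⟩
    · simp only [nonvanishingLocus, Set.mem_ofPred_eq, map_mul] at hpf hpg ⊢
      exact mul_ne_zero hpf hpg
    · simp only [nonvanishingLocus, Set.mem_ofPred_eq, map_mul] at hq
      exact ⟨hfV (left_ne_zero_of_mul hq), hgV (right_ne_zero_of_mul hq)⟩
  | sUnion S _ ih =>
    obtain ⟨V, hVS, hpV⟩ := hp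
    obtain ⟨f, d, hf, hpf, hfV⟩ := ih V hVS hpV
    exact ⟨f, d, hf, hpf, hfV.trans (Set.subset_sUnion_of_mem hVS)⟩

lemma exists_rep_eq_smul {x : Fin n → Fin (N + 1) → k} (hx : ∀ i, x i ≠ 0) :
    ∃ c : Fin n → k, (∀ i, c i ≠ 0) ∧
      ∀ i, (Projectivization.mk k (x i) (hx i)).rep = c i • x i := by
  choose a ha using fun i => Projectivization.exists_smul_eq_mk_rep k (x i) (hx i)
  exact ⟨fun i => a i, fun i => (a i).ne_zero, fun i => (ha i).symm⟩

/-- `(ℙ^N)^n` is irreducible. -/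
lemma inter_nonempty_of_isOpen [Infinite k] {V V' : Set (Fin n → ProjSpace k N)}
    (hV : IsOpen[zariskiTopology k N n] V) (hV' : IsOpen[zariskiTopology k N n] V')
    (hne : V.Nonempty) (hne' : V'.Nonempty) : (V ∩ V').Nonempty := by
  obtain ⟨p, hp⟩ := hne
  obtain ⟨p', hp'⟩ := hne'
  obtain ⟨f, d, hf, hpf, hfV⟩ := exists_nonvanishingLocus_subset hV hp
  obtain ⟨g, e, hg, hpg, hgV⟩ := exists_nonvanishingLocus_subset hV' hp'
  have hf0 : f ≠ 0 := by
    rintro rfl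
    simp [nonvanishingLocus] at hpf
  have hg0 : g ≠ 0 := by
    rintro rfl
    simp [nonvanishingLocus] at hpg
  -- The last factor forces the coordinate vectors at the chosen point to be nonzero, so that they
  -- define points of `ℙ^N`.
  have h0 : f * g * ∏ i : Fin n, X (i, 0) ≠ 0 :=
    mul_ne_zero (mul_ne_zero hf0 hg0) (Finset.prod_ne_zero_iff.mpr fun i _ => X_ne_zero _)
  obtain ⟨x, hx⟩ : ∃ x, eval x (f * g * ∏ i : Fin n, X (i, 0)) ≠ 0 := by
    by_contra h
    push Not at h
    exact h0 (MvPolynomial.funext fun x => by rw [h x, map_zero])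
  simp only [map_mul, map_prod, eval_X, mul_ne_zero_iff, Finset.prod_ne_zero_iff] at hx
  obtain ⟨⟨hxf, hxg⟩, hx0⟩ := hx
  let y : Fin n → Fin (N + 1) → k := fun i j => x (i, j)
  have hy : ∀ i, y i ≠ 0 := fun i h => hx0 i (Finset.mem_univ i) (congrFun h 0)
  obtain ⟨c, hc, hrep⟩ := exists_rep_eq_smul hy
  have hcd : ∀ d : Fin n → ℕ, ∏ i, c i ^ d i ≠ 0 := fun d =>
    Finset.prod_ne_zero_iff.mpr fun i _ => pow_ne_zero _ (hc i)
  refine ⟨fun i => Projectivization.mk k (y i) (hy i), hfV ?_, hgV ?_⟩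
  · simp only [nonvanishingLocus, Set.mem_ofPred_eq, hrep]
    rw [hf.eval_smul]
    exact mul_ne_zero (hcd d) hxf
  · simp only [nonvanishingLocus, Set.mem_ofPred_eq, hrep]
    rw [hg.eval_smul]
    exact mul_ne_zero (hcd e) hxg

end Zariski

/-! ### Descent to the Chow variety. -/

section ZeroCycle

variable {k : Type*} [Field k] {N n : ℕ}

lemma exists_perm_of_ofTuple_eq {p q : Fin n → ProjSpace k N}
    (h : ZeroCycle.ofTuple p = ZeroCycle.ofTuple q) : ∃ e : Equiv.Perm (Fin n), p = q ∘ e := by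
  classical
  have h1 : Finset.univ.val.map p = Finset.univ.val.map q := congrArg Subtype.val h
  have h2 : ∀ y, Nonempty ({i // p i = y} ≃ {i // q i = y}) := fun y => by
    refine ⟨Fintype.equivOfCardEq ?_⟩
    have := congrArg (Multiset.count y) h1
    rw [Multiset.count_map, Multiset.count_map] at this
    rw [Fintype.card_subtype, Fintype.card_subtype]
    simpa [Finset.card_def, Finset.filter_val, eq_comm] using this
  refine ⟨Equiv.ofFiberEquiv fun y => (h2 y).some, ?_⟩
  ext i : 1
  exact (Equiv.ofFiberEquiv_map _ i).symm

lemma ofTuple_surjective :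
    Function.Surjective (ZeroCycle.ofTuple : (Fin n → ProjSpace k N) → ZeroCycle k N n) := by
  rintro ⟨s, hs⟩
  induction s using Quotient.inductionOn with
  | _ l =>
    subst hs
    refine ⟨l.get, Subtype.ext ?_⟩
    change Finset.univ.val.map l.get = (l : Multiset _)
    rw [Fin.univ_val_map, List.ofFn_get]

/-- The cycles `p_1 + ⋯ + p_n` such that no nonzero form of degree `d` has multiplicities at least
`m_1, …, m_n` with `m_1 + ⋯ + m_n = M` at `p_1, …, p_n`. -/
def noFormLocus (k : Type*) [Field k] (N n d M : ℕ) : Set (ZeroCycle k N n) :=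
  {c | ∀ p, ZeroCycle.ofTuple p = c → ∀ m : Fin n → ℕ, ∑ i, m i = M →
    NoForm (fun i => (p i).rep) d m}

/-- Since all `m` of sum `M` are allowed, the condition is invariant under permutations and can be
tested on one ordering of the points. -/
lemma ofTuple_mem_noFormLocus {d M : ℕ} {p : Fin n → ProjSpace k N} :
    ZeroCycle.ofTuple p ∈ noFormLocus k N n d M ↔
      ∀ m : Fin n → ℕ, ∑ i, m i = M → NoForm (fun i => (p i).rep) d m := by
  refine ⟨fun h => h p rfl, fun h q hq m hm => ?_⟩
  obtain ⟨e, rfl⟩ := exists_perm_of_ofTuple_eq hq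
  refine NoForm.of_perm (v := fun i => (p i).rep) e (h _ ?_)
  rw [← hm]
  exact Equiv.sum_comp e.symm m

lemma isOpen_noFormLocus (d M : ℕ) : IsOpen (noFormLocus k N n d M) := by
  rw [isOpen_coinduced]
  let _ := zariskiTopology k N n
  -- Only finitely many `m` have sum `M`, so the intersection stays open.
  have : ZeroCycle.ofTuple ⁻¹' noFormLocus k N n d M =
      ⋂ m ∈ Finset.piAntidiag (Finset.univ : Finset (Fin n)) M,
        {p | NoForm (fun i => (p i).rep) d m} := by
    ext p
    rw [Set.mem_preimage, ofTuple_mem_noFormLocus]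
    simp
  rw [this]
  exact isOpen_biInter_finset fun m _ => isOpen_setOf_noForm d m

lemma dense_of_isOpen_of_nonempty [Infinite k] {U : Set (ZeroCycle k N n)} (hU : IsOpen U)
    (hne : U.Nonempty) : Dense U := by
  rw [dense_iff_inter_open]
  intro V hV hVne
  obtain ⟨p, hp⟩ := inter_nonempty_of_isOpen (isOpen_coinduced.mp hV) (isOpen_coinduced.mp hU)
    (hVne.preimage ofTuple_surjective) (hne.preimage ofTuple_surjective)
  exact ⟨ZeroCycle.ofTuple p, hp⟩

end ZeroCycle

/-! ### The special configuration of points. -/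

section Configuration

/-- Integral points whose reductions modulo suitable primes contain, up to a cyclic permutation, a
triangular grid. The forms of degree `d` through their reductions are controlled on average. -/
lemma exists_points_noForm_zmod {N n b : ℕ} (hN : 1 ≤ N) (hn : 1 ≤ n)
    (hb : (b + N).choose N ≤ n) :
    ∃ x : Fin n → Fin N → ℕ, Function.Injective x ∧
      ∀ (d M : ℕ) (m : Fin n → ℕ), ∑ i, m i = M → n * N * d < (b + N) * M →
        ∃ p : ℕ, p.Prime ∧
          NoForm (fun i => (Fin.cons 1 fun j => (x i j : ZMod p) : Fin (N + 1) → ZMod p)) d m := by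
  classical
  have : NeZero n := ⟨by omega⟩
  have : NeZero N := ⟨by omega⟩
  obtain ⟨S, hS, hSn⟩ := Infinite.exists_superset_card_eq (triangle N b) n
    (by rwa [card_triangle])
  let T : S ≃ Fin n := S.equivFinOfCardEq hSn
  -- Primes above `B` separate the numbers `0, …, b` and all coordinates of points of `S`.
  let B : ℕ := b + 1 + ∑ a ∈ S, ∑ j, a j
  have hB : ∀ t j, (T.symm t).1 j < B := fun t j => by
    have h1 : (T.symm t).1 j ≤ ∑ j, (T.symm t).1 j :=
      Finset.single_le_sum (f := (T.symm t).1) (fun _ _ => Nat.zero_le _) (Finset.mem_univ j)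
    have h2 : ∑ j, (T.symm t).1 j ≤ ∑ a ∈ S, ∑ j, a j :=
      Finset.single_le_sum (f := fun a => ∑ j, a j) (fun _ _ => Nat.zero_le _) (T.symm t).2
    omega
  let ℓ : Fin n → ℕ := fun j => Nat.nth Nat.Prime (B + j)
  have hℓ : ∀ j, (ℓ j).Prime := fun j => Nat.prime_nth_prime _
  have hℓB : ∀ j, B < ℓ j := fun j => by
    have := Nat.add_two_le_nth_prime (B + j)
    change B < Nat.nth Nat.Prime (B + j)
    omega
  have hℓinj : Function.Injective ℓ := fun j j' h => by
    have := Nat.nth_injective Nat.infinite_setOfPred_prime h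
    exact Fin.ext (by omega)
  -- Addition in `Fin n` is modulo `n`: modulo the `j`-th prime, the point `i` reduces to the point
  -- of `S` labelled `i + j`. The grid point `a` is thus the reduction of the point `T a - j`.
  choose x hx using fun (i : Fin n) (c : Fin N) =>
    (⟨_, (Nat.chineseRemainderOfFinset (fun j => (T.symm (i + j)).1 c) ℓ Finset.univ
      (fun j _ => (hℓ j).ne_zero)
      (fun j _ j' _ h => (Nat.coprime_primes (hℓ j) (hℓ j')).mpr
        fun h' => h (hℓinj h'))).2⟩ :
      ∃ y : ℕ, ∀ j ∈ Finset.univ, y ≡ (T.symm (i + j)).1 c [MOD ℓ j])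
  refine ⟨x, fun i i' h => ?_, fun d M m hm hlt => ?_⟩
  · have h1 : (T.symm i).1 = (T.symm i').1 := by
      ext c
      have h2 := hx i c 0 (Finset.mem_univ _)
      have h3 := hx i' c 0 (Finset.mem_univ _)
      rw [add_zero] at h2 h3
      rw [h] at h2
      exact (h2.symm.trans h3).eq_of_lt_of_lt ((hB _ _).trans (hℓB 0)) ((hB _ _).trans (hℓB 0))
    exact T.symm.injective (Subtype.ext h1)
  · by_contra hno
    push Not at hno
    -- Were there a nonzero form modulo the `j`-th prime, its dehomogenization would obey the grid
    -- bound with the multiplicities shifted by `j`.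
    have key : ∀ j : Fin n, ∑ a ∈ (triangle N b).attach, m (T ⟨a.1, hS a.2⟩ - j) ≤
        triangleConst N b * d := by
      intro j
      have hj := hno (ℓ j) (hℓ j)
      have : Fact (ℓ j).Prime := ⟨hℓ j⟩
      simp only [NoForm, not_forall] at hj
      obtain ⟨F, hF, hv, hF0⟩ := hj
      have hcast : ∀ i i' : ℕ, i ≤ b → i' ≤ b → (i : ZMod (ℓ j)) = i' → i = i' := by
        intro i i' hi hi' h
        rw [ZMod.natCast_eq_natCast_iff] at h
        have := hℓB j
        exact h.eq_of_lt_of_lt (by omega) (by omega)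
      have := sum_orders_triangle_le N b d hcast (slice 1 F) (slice_one_ne_zero hF0 hF)
        ((totalDegree_slice_le _ _).trans hF.totalDegree_le)
        (fun a => if h : a ∈ triangle N b then m (T ⟨a, hS h⟩ - j) else 0) (by
          intro a ha
          rw [dif_pos ha]
          have h1 := (hv (T ⟨a, hS ha⟩ - j)).slice
          have h2 : (fun c => (a c : ZMod (ℓ j))) =
              fun c => (x (T ⟨a, hS ha⟩ - j) c : ZMod (ℓ j)) := by
            refine _root_.funext fun c => ?_
            have h3 := hx (T ⟨a, hS ha⟩ - j) c j (Finset.mem_univ _)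
            rw [sub_add_cancel, Equiv.symm_apply_apply] at h3
            exact ((ZMod.natCast_eq_natCast_iff _ _ _).mpr h3).symm
          rw [h2]
          exact h1)
      rw [← Finset.sum_attach] at this
      refine le_trans (le_of_eq (Finset.sum_congr rfl fun a _ => ?_)) this
      rw [dif_pos a.2]
    have hsum := Finset.sum_le_sum fun j (_ : j ∈ (Finset.univ : Finset (Fin n))) => key j
    rw [Finset.sum_comm] at hsum
    -- Over all shifts, each grid point meets every multiplicity exactly once.
    have hinner : ∀ t : Fin n, ∑ j, m (t - j) = M := fun t => by
      rw [← hm]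
      exact Equiv.sum_comp (Equiv.subLeft t) m
    simp only [hinner, Finset.sum_const, Finset.card_attach, card_triangle, Finset.card_univ,
      Fintype.card_fin, smul_eq_mul] at hsum
    obtain ⟨N', rfl⟩ : ∃ N', N = N' + 1 := ⟨N - 1, by omega⟩
    -- The ratio of the size of the grid to the Schwartz–Zippel constant is `(b + N) / N`, which
    -- turns the averaged bound into `(b + N) * M ≤ n * N * d`.
    have hid : (b + (N' + 1)) * (b + N').choose N' = (b + (N' + 1)).choose (N' + 1) * (N' + 1) :=
      Nat.add_one_mul_choose_eq (b + N') N'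
    have hpos : 0 < (b + N').choose N' := Nat.choose_pos (by omega)
    rw [triangleConst] at hsum
    have h1 := Nat.mul_lt_mul_of_pos_right hlt hpos
    have h2 := Nat.mul_le_mul_right (N' + 1) hsum
    nlinarith

/-- A set of `n` distinct points on which every form satisfies the expected inequality between its
degree and its multiplicities. -/
lemma exists_ofFinset_mem_noFormLocus (k : Type*) [Field k] [CharZero k] {N n b : ℕ} (hN : 1 ≤ N)
    (hn : 1 ≤ n) (hb : (b + N).choose N ≤ n) :
    ∃ (X : Finset (ProjSpace k N)) (hX : X.card = n), ∀ d M : ℕ, n * N * d < (b + N) * M →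
      ZeroCycle.ofFinset X hX ∈ noFormLocus k N n d M := by
  obtain ⟨x, hxinj, hx⟩ := exists_points_noForm_zmod hN hn hb
  let v : Fin n → Fin (N + 1) → ℤ := fun i => Fin.cons 1 fun j => (x i j : ℤ)
  let w : Fin n → Fin (N + 1) → k := fun i j => (v i j : k)
  have hw : ∀ i, w i ≠ 0 := fun i h => by
    have := congrFun h 0
    simp [w, v] at this
  let P : Fin n → ProjSpace k N := fun i => Projectivization.mk k (w i) (hw i)
  have hP : Function.Injective P := fun i i' h => by
    obtain ⟨a, ha⟩ := (Projectivization.mk_eq_mk_iff' k _ _ (hw i) (hw i')).mp h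
    have h0 := congrFun ha 0
    have ha1 : a = 1 := by simpa [w, v] using h0
    refine hxinj (funext fun j => ?_)
    have hj := congrFun ha j.succ
    simpa [w, v, ha1, eq_comm] using hj
  refine ⟨Finset.univ.map ⟨P, hP⟩, by simp, fun d M hdM => ?_⟩
  change ZeroCycle.ofTuple P ∈ _
  rw [ofTuple_mem_noFormLocus]
  intro m hm
  obtain ⟨p, hp, hno⟩ := hx d M m hm hdM
  have : Fact p.Prime := ⟨hp⟩
  have hno' : NoForm (fun i j => (v i j : ZMod p)) d m := by
    convert hno using 1
    ext i j
    refine Fin.cases ?_ (fun j => ?_) j <;> simp [v]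
  obtain ⟨c, hc, hrep⟩ := exists_rep_eq_smul hw
  have := (NoForm.of_zmod (k := k) hno').smul c hc
  convert this using 1
  ext i : 1
  exact hrep i

end Configuration

/-! ### Conclusion. -/

lemma exists_choose_le_lt {N n : ℕ} (hN : 1 ≤ N) (hn : 1 ≤ n) :
    ∃ b, (b + N).choose N ≤ n ∧ n < (b + 1 + N).choose N := by
  classical
  have hex : ∃ b, n < (b + 1 + N).choose N := by
    refine ⟨n, ?_⟩
    obtain ⟨N', rfl⟩ : ∃ N', N = N' + 1 := ⟨N - 1, by omega⟩
    calc n < (n + 1 + 1).choose 1 := by rw [Nat.choose_one_right]; omega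
      _ = (n + 1 + 1).choose (n + 1) := Nat.choose_symm_of_eq_add (by omega)
      _ ≤ (n + 1 + (N' + 1)).choose (n + 1) := Nat.choose_le_choose _ (by omega)
      _ = _ := Nat.choose_symm_add
  refine ⟨Nat.find hex, ?_, Nat.find_spec hex⟩
  rcases h : Nat.find hex with _ | b
  · simpa using hn
  · exact not_lt.mp (Nat.find_min hex (m := b) (by omega))

lemma le_div_of_mem_noFormLocus {k : Type*} [Field k] {N n s d : ℕ} {X : Finset (ProjSpace k N)}
    (hN : 1 ≤ N) (hX : X.card = n)
    (h : ∀ M : ℕ, n * N * d < s * M → ZeroCycle.ofFinset X hX ∈ noFormLocus k N n d M)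
    {F : MvPolynomial (Fin (N + 1)) k} (hF : F ≠ 0) (hd : F.IsHomogeneous d)
    (hp : ∃ p ∈ X, F ∈ pointIdeal p) :
    (s : ℝ) / (n * N) ≤ d / ((∑ p ∈ X, mult p F : ℕ) : ℝ) := by
  obtain ⟨q, hq, hFq⟩ := hp
  -- Passing through a point of `X` makes the denominator positive, so the quotient is not the
  -- default value `0` of division by zero.
  have hM : 0 < ∑ p ∈ X, mult p F :=
    Finset.sum_pos' (fun _ _ => Nat.zero_le _) ⟨q, hq, one_le_mult hF hFq⟩
  have hn : 0 < n := hX ▸ Finset.card_pos.mpr ⟨q, hq⟩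
  have key : s * ∑ p ∈ X, mult p F ≤ n * N * d := by
    by_contra hlt
    let e : Fin n ≃ X := (X.equivFinOfCardEq hX).symm
    let P : Fin n ↪ ProjSpace k N := e.toEmbedding.trans (Function.Embedding.subtype _)
    have hPX : Finset.univ.map P = X := by
      ext y
      simp only [Finset.mem_map, Finset.mem_univ, true_and]
      exact ⟨fun ⟨i, hi⟩ => hi ▸ (e i).2, fun hy => ⟨e.symm ⟨y, hy⟩, by simp [P]⟩⟩
    have hcycle : ZeroCycle.ofFinset X hX = ZeroCycle.ofTuple P :=
      Subtype.ext (congrArg Finset.val hPX).symm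
    have hmem := h _ (not_le.mp hlt)
    rw [hcycle, ofTuple_mem_noFormLocus] at hmem
    refine hF (hmem (fun i => mult (P i) F) ?_ F hd fun i =>
      vanishesToOrder_of_mem_pointIdeal_pow (mem_pointIdeal_pow_mult hF (P i)))
    conv_rhs => rw [← hPX]
    rw [Finset.sum_map]
  rw [div_le_div_iff₀ (by positivity) (by exact_mod_cast hM)]
  have : ((s * ∑ p ∈ X, mult p F : ℕ) : ℝ) ≤ ((n * N * d : ℕ) : ℝ) := Nat.cast_le.mpr key
  push_cast at this ⊢
  linarith

end SeshadriPoints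

theorem corollary2p8 (k : Type*) [Field k] [IsAlgClosed k] [CharZero k]
    (N n : ℕ) (hN : 2 ≤ N) (hn : 1 ≤ n) :
    SeshadriPoints.HoldsForVeryGeneralPoints k N n (fun X =>
      SeshadriPoints.seshadriConstant X ≥
        (((SeshadriPoints.initialDegree X : ℝ) + (N : ℝ) - 1) / ((n : ℝ) * (N : ℝ))) ^
          (1 / ((N : ℝ) - 1))) := by
  open SeshadriPoints in
  obtain ⟨b, hbn, hnb⟩ := exists_choose_le_lt (N := N) (by omega) hn
  obtain ⟨X₀, hX₀, hmem⟩ := exists_ofFinset_mem_noFormLocus k (by omega) hn hbn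
  -- The pairs `(d, M)` are enumerated by `Nat.unpair`; those on which nothing is imposed contribute
  -- the whole space. The special cycle lies in every set, which gives density as well as the
  -- required member of `W`.
  have hU : ∀ i : ℕ, ZeroCycle.ofFinset X₀ hX₀ ∈
      if n * N * i.unpair.1 < (b + N) * i.unpair.2 then noFormLocus k N n i.unpair.1 i.unpair.2
      else Set.univ := fun i => by
    split_ifs with h
    · exact hmem _ _ h
    · exact Set.mem_univ _
  have hopen : ∀ i : ℕ, IsOpen
      (if n * N * i.unpair.1 < (b + N) * i.unpair.2 then noFormLocus k N n i.unpair.1 i.unpair.2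
      else Set.univ) := fun i => by
    split_ifs
    · exact isOpen_noFormLocus _ _
    · exact isOpen_univ
  refine ⟨_, fun i => ⟨hopen i, dense_of_isOpen_of_nonempty (hopen i) ⟨_, hU i⟩⟩,
    ⟨X₀, hX₀, Set.mem_iInter.mpr hU⟩, fun X hX hXU => ?_⟩
  obtain ⟨G, hG, hGd, hGX⟩ := exists_form_mem_setIdeal X (hX.trans_lt hnb)
  have hα : initialDegree X ≤ b + 1 := Nat.sInf_le ⟨G, hG, hGd, hGX⟩
  have hαR : (initialDegree X : ℝ) ≤ b + 1 := by exact_mod_cast hα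
  have hNR : (2 : ℝ) ≤ N := by exact_mod_cast hN
  have hloc : ∀ d M : ℕ, n * N * d < (b + N) * M →
      ZeroCycle.ofFinset X hX ∈ noFormLocus k N n d M := fun d M h => by
    have := Set.mem_iInter.mp hXU (Nat.pair d M)
    rwa [Nat.unpair_pair, if_pos h] at this
  obtain ⟨q, hq⟩ : X.Nonempty := Finset.card_pos.mp (by omega)
  refine Real.rpow_le_rpow (div_nonneg (by linarith [Nat.cast_nonneg (α := ℝ) (initialDegree X)])
    (by positivity)) ?_ (one_div_nonneg.mpr (by linarith))
  -- The form `G` that bounds `α(X)` also shows that the set of quotients is nonempty, as the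
  -- infimum requires.
  refine le_csInf ⟨_, b + 1, G, hG, hGd, ⟨q, hq, ?_⟩, rfl⟩ ?_
  · rw [setIdeal, Ideal.mem_iInf] at hGX
    exact (Ideal.mem_iInf.mp (hGX q)) hq
  · rintro r ⟨d, F, hF, hd, hp, rfl⟩
    refine le_trans ?_ (le_div_of_mem_noFormLocus (s := b + N) (by omega) hX (hloc d) hF hd hp)
    push_cast
    gcongr
    linarith
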